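/- Let $\mathcal{Q}_2$ be the 2-adic ring $C^*$-algebra, i.e. the universal unital $C^*$-algebra generated by a unitary $u$ and an isometry $s_2$ satisfying $$s_2u=u^2s_2,\qquad s_2s_2^*+u s_2s_2^*u^{-1}=1 .$$ Put $s_1:=us_2$ and let $\mathcal{O}_2:=C^*(s_1,s_2)\subseteq\mathcal{Q}_2$ be the canonical copy of the Cuntz algebra. Let $\sigma$ be the flip-flop symmetry extended to $\mathcal{Q}_2$, i.e. the $^*$-automorphism of $\mathcal{Q}_2$ determined by $\sigma(s_2)=s_1$ and $\sigma(u)=u^*$ (so that $\sigma(s_1)=s_2$), and let $\mathcal{Q}_2^\sigma:=\{a\in\mathcal{Q}_2:\sigma(a)=a\}$ be its fixed-point algebra. Set $$T:=\tfrac{1}{\sqrt2}(s_1+s_2),\qquad V:=\tfrac{1}{\sqrt2}(s_1-s_2)(s_1s_1^*-s_2s_2^*),\qquad R:=u+u^* .$$ Then $$\mathcal{Q}_2^\sigma = C^*(T,V,R)=C^*\big(xu^h+\sigma(x)u^{-h} : x\in\mathcal{O}_2,\ h\in\mathbb{Z}\big),$$ where $C^*(S)$ denotes the smallest $C^*$-subalgebra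 of $\mathcal{Q}_2$ containing $S$. -/

import Mathlib

open scoped ENNReal

universe v

noncomputable section

namespace TwoAdic

/-! ### The 2-adic ring C*-algebra -/

/-- A pair `(u, s)` in a unital C*-algebra satisfying the defining relations of the 2-adic ring
C*-algebra: `u` is a unitary (so `u⁻¹ = star u`), `s` is an isometry,
`s u = u² s` and `s s* + u s s* u⁻¹ = 1`. -/
structure IsPair {B : Type*} [CStarAlgebra B] (u s : B) : Prop where
  unitary : u ∈ unitary B
  isometry : star s * s = 1
  intertwine : s * u = u ^ 2 * s
  range_sum : s * star s + u * (s * star s) * star u = 1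

/-- A representation of the relations in a nonzero unital C*-algebra. Restricting the carrier to
`Type` loses nothing: a C*-algebra generated by two elements has at most continuum many elements;
see `existsUnique_hom` below. -/
structure Rep where
  carrier : Type
  [cstar : CStarAlgebra carrier]
  [nontriv : Nontrivial carrier]
  u : carrier
  s : carrier
  isPair : IsPair u s

attribute [instance] Rep.cstar Rep.nontriv

/-- The `ℓ^∞`-product of all representations of the relations. -/
abbrev Ambient : Type 1 := lp (fun π : Rep => π.carrier) ∞

instance : CStarAlgebra Ambient where
  __ := (lp.inftyNormedRing : NormedRing Ambient)
  __ := (inferInstance : StarRing Ambient)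
  __ := (inferInstance : CompleteSpace Ambient)
  __ := (inferInstance : CStarRing Ambient)
  __ := (inferInstance : NormedAlgebra ℂ Ambient)
  __ := (inferInstance : StarModule ℂ Ambient)

theorem IsPair.norm_u_le {B : Type*} [CStarAlgebra B] [Nontrivial B] {u s : B} (h : IsPair u s) :
    ‖u‖ ≤ 1 := (CStarRing.norm_of_mem_unitary h.unitary).le

theorem IsPair.norm_s_le {B : Type*} [CStarAlgebra B] [Nontrivial B] {u s : B} (h : IsPair u s) :
    ‖s‖ ≤ 1 := by
  have h1 : ‖s‖ * ‖s‖ = 1 := by rw [← CStarRing.norm_star_mul_self, h.isometry, norm_one]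
  nlinarith [norm_nonneg s]

/-- The unitary generator in the product of all representations. -/
def ambientU : Ambient :=
  ⟨fun π => π.u, memℓp_infty ⟨1, by rintro _ ⟨π, rfl⟩; exact π.isPair.norm_u_le⟩⟩

/-- The isometric generator in the product of all representations. -/
def ambientS : Ambient :=
  ⟨fun π => π.s, memℓp_infty ⟨1, by rintro _ ⟨π, rfl⟩; exact π.isPair.norm_s_le⟩⟩

theorem isPair_ambient : IsPair ambientU ambientS where
  unitary := by
    rw [Unitary.mem_iff]
    constructor <;> ext π
    · exact (Unitary.mem_iff.1 π.isPair.unitary).1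
    · exact (Unitary.mem_iff.1 π.isPair.unitary).2
  isometry := by ext π; exact π.isPair.isometry
  intertwine := by
    rw [pow_two]; ext π; exact π.isPair.intertwine.trans (by rw [pow_two]; rfl)
  range_sum := by ext π; exact π.isPair.range_sum

/-- The C*-subalgebra generated by the two universal generators. -/
def universalSubalgebra : StarSubalgebra ℂ Ambient :=
  (StarAlgebra.adjoin ℂ {ambientU, ambientS}).topologicalClosure

instance : IsClosed (universalSubalgebra : Set Ambient) :=
  StarSubalgebra.isClosed_topologicalClosure _

/-- The 2-adic ring C*-algebra: the universal unital C*-algebra generated by a unitary `u` and an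
isometry `s₂` with `s₂ u = u² s₂` and `s₂ s₂* + u s₂ s₂* u⁻¹ = 1`. -/
def Q₂ : Type 1 := universalSubalgebra

instance : CStarAlgebra Q₂ := inferInstanceAs (CStarAlgebra universalSubalgebra)

theorem ambientU_mem : ambientU ∈ universalSubalgebra :=
  StarSubalgebra.le_topologicalClosure _ (StarAlgebra.subset_adjoin ℂ _ (by simp))

theorem ambientS_mem : ambientS ∈ universalSubalgebra :=
  StarSubalgebra.le_topologicalClosure _ (StarAlgebra.subset_adjoin ℂ _ (by simp))

namespace Q₂

/-- The unitary generator, as an element of the unitary group. -/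
def u : unitary Q₂ :=
  ⟨(⟨ambientU, ambientU_mem⟩ : universalSubalgebra), by
    have h := Unitary.mem_iff.1 isPair_ambient.unitary
    exact Unitary.mem_iff.2 ⟨Subtype.ext h.1, Subtype.ext h.2⟩⟩

/-- The isometric generator. -/
def s₂ : Q₂ := (⟨ambientS, ambientS_mem⟩ : universalSubalgebra)

/-- The second Cuntz isometry. -/
def s₁ : Q₂ := u * s₂

end Q₂

theorem isPair_gen : IsPair (Q₂.u : Q₂) Q₂.s₂ where
  unitary := Q₂.u.2
  isometry := Subtype.ext isPair_ambient.isometry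
  intertwine := Subtype.ext isPair_ambient.intertwine
  range_sum := Subtype.ext isPair_ambient.range_sum

/-! ### The universal property -/

/-- The generators generate a dense *-subalgebra. -/
theorem dense_adjoin :
    (StarAlgebra.adjoin ℂ {(Q₂.u : Q₂), Q₂.s₂}).topologicalClosure = ⊤ := by
  let ι : Q₂ →⋆ₐ[ℂ] Ambient := universalSubalgebra.subtype
  have hι : Topology.IsInducing ι := Topology.IsInducing.subtypeVal
  have himg : (StarAlgebra.adjoin ℂ {(Q₂.u : Q₂), Q₂.s₂}).map ι
      = StarAlgebra.adjoin ℂ {ambientU, ambientS} := by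
    rw [StarAlgHom.map_adjoin, Set.image_pair]; rfl
  rw [eq_top_iff]
  intro x _
  rw [← SetLike.mem_coe, StarSubalgebra.topologicalClosure_coe,
    hι.closure_eq_preimage_closure_image, Set.mem_preimage]
  have h2 : (ι '' (StarAlgebra.adjoin ℂ {(Q₂.u : Q₂), Q₂.s₂} : Set Q₂))
      = (StarAlgebra.adjoin ℂ {ambientU, ambientS} : Set Ambient) := by
    rw [← himg]; rfl
  rw [h2, ← StarSubalgebra.topologicalClosure_coe]
  exact Subtype.property (p := fun y => y ∈ universalSubalgebra) x

open scoped CStarAlgebra in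
/-- Unital *-homomorphisms out of `Q₂` are determined by the images of the generators. -/
theorem hom_ext {B : Type v} [CStarAlgebra B] {φ ψ : Q₂ →⋆ₐ[ℂ] B}
    (hu : φ Q₂.u = ψ Q₂.u) (hs : φ Q₂.s₂ = ψ Q₂.s₂) : φ = ψ := by
  have hle : StarAlgebra.adjoin ℂ {(Q₂.u : Q₂), Q₂.s₂} ≤ StarAlgHom.equalizer φ ψ := by
    apply StarAlgHom.adjoin_le_equalizer
    rintro x (rfl | rfl)
    · exact hu
    · exact hs
  have hcl : IsClosed (StarAlgHom.equalizer φ ψ : Set Q₂) :=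
    isClosed_eq (map_continuous φ) (map_continuous ψ)
  have := StarSubalgebra.topologicalClosure_minimal hle hcl
  rw [dense_adjoin] at this
  ext x
  exact this (StarSubalgebra.mem_top (x := x))

/-- A C*-algebra whose underlying set is small is isomorphic to one in `Type`. -/
theorem exists_small_model (A : Type v) [CStarAlgebra A] [Small.{0} A] :
    ∃ (A' : Type) (_ : CStarAlgebra A'), Nonempty (A' ≃⋆ₐ[ℂ] A) := by
  let e : Shrink.{0} A ≃ₐ[ℂ] A := Shrink.algEquiv ℂ A
  let n1 : NormedRing (Shrink.{0} A) := NormedRing.induced _ A e e.injective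
  have hiso : Isometry e := AddMonoidHomClass.isometry_of_norm e (fun _ => rfl)
  let st : StarRing (Shrink.{0} A) :=
    { star := fun x => e.symm (star (e x))
      star_involutive := fun x => by
        change e.symm (star (e (e.symm (star (e x))))) = x
        simp
      star_mul := fun x y => by
        change e.symm (star (e (x * y))) = e.symm (star (e y)) * e.symm (star (e x))
        simp
      star_add := fun x y => by
        change e.symm (star (e (x + y))) = e.symm (star (e x)) + e.symm (star (e y))
        simp }
  have hstar : ∀ x, e (star x) = star (e x) := fun x => e.apply_symm_apply _
  have hnorm : ∀ x, ‖x‖ = ‖e x‖ := fun _ => rfl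
  let c : CStarAlgebra (Shrink.{0} A) :=
    { n1, st with
      toAlgebra := inferInstance
      complete := fun {f} hf => by
        have := (hiso.isUniformInducing.completeSpace_congr e.surjective).2 inferInstance
        exact this.complete hf
      norm_mul_self_le := fun x => by
        rw [hnorm, hnorm, map_mul, hstar]
        exact CStarRing.norm_star_mul_self.symm.le
      norm_smul_le := fun r x => by
        rw [hnorm, hnorm, map_smul]; exact norm_smul_le r (e x)
      star_smul := fun r x => e.injective (by
        rw [hstar, map_smul, map_smul, hstar, star_smul]) }
  exact ⟨Shrink.{0} A, c, ⟨StarAlgEquiv.ofAlgEquiv e hstar⟩⟩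

/-- A C*-algebra generated by two elements is small. -/
theorem small_generated {B : Type v} [CStarAlgebra B] (u s : B) :
    Small.{0} (StarAlgebra.adjoin ℂ {u, s}).topologicalClosure := by
  let g : Fin 4 → B := ![u, s, star u, star s]
  have hsub : ∀ x ∈ StarAlgebra.adjoin ℂ {u, s}, ∃ a, FreeAlgebra.lift ℂ g a = x := by
    intro x hx
    have h1 : ({u, s} : Set B) ∪ star {u, s} ⊆ Set.range g := by
      rintro y ((rfl | rfl) | (hy | hy))
      · exact ⟨0, rfl⟩
      · exact ⟨1, rfl⟩
      · exact ⟨2, by rw [← star_star y, hy]; rfl⟩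
      · exact ⟨3, by rw [← star_star y, Set.mem_singleton_iff.1 hy]; rfl⟩
    have h2 : x ∈ Algebra.adjoin ℂ (Set.range g) := Algebra.adjoin_mono h1 hx
    rw [Algebra.adjoin_range_eq_range_freeAlgebra_lift] at h2
    exact h2
  refine small_of_injective_of_exists (γ := B)
    (fun c : ℕ → FreeAlgebra ℂ (Fin 4) =>
      Filter.limUnder Filter.atTop (fun n => FreeAlgebra.lift ℂ g (c n)))
    Subtype.val_injective ?_
  rintro ⟨b, hb⟩
  obtain ⟨x, hx, hlim⟩ := mem_closure_iff_seq_limit.1 hb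
  choose c hc using fun n => hsub (x n) (hx n)
  exact ⟨c, by simpa only [hc] using hlim.limUnder_eq⟩

/-- The coordinate projection of the product of all representations. -/
def evalHom (π : Rep) : Ambient →⋆ₐ[ℂ] π.carrier where
  toFun x := x π
  map_one' := rfl
  map_mul' _ _ := rfl
  map_zero' := rfl
  map_add' _ _ := rfl
  commutes' _ := rfl
  map_star' _ := rfl

/-- The universal property of `Q₂`, for unital C*-algebras in an arbitrary universe. -/
theorem existsUnique_hom {B : Type v} [CStarAlgebra B] {u s : B} (h : IsPair u s) :
    ∃! φ : Q₂ →⋆ₐ[ℂ] B, φ Q₂.u = u ∧ φ Q₂.s₂ = s := by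
  refine existsUnique_of_exists_of_unique ?_ ?_
  · rcases subsingleton_or_nontrivial B with hB | hB
    · exact ⟨{ toFun := fun _ => 0
               map_one' := Subsingleton.elim _ _
               map_mul' := fun _ _ => Subsingleton.elim _ _
               map_zero' := rfl
               map_add' := fun _ _ => Subsingleton.elim _ _
               commutes' := fun _ => Subsingleton.elim _ _
               map_star' := fun _ => Subsingleton.elim _ _ },
        Subsingleton.elim _ _, Subsingleton.elim _ _⟩
    · let C := (StarAlgebra.adjoin ℂ {u, s}).topologicalClosure
      have : IsClosed (C : Set B) := StarSubalgebra.isClosed_topologicalClosure _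
      let cC : CStarAlgebra C := StarSubalgebra.cstarAlgebra C
      have : Small.{0} C := small_generated u s
      obtain ⟨A, cA, ⟨e⟩⟩ := exists_small_model C
      have hu : u ∈ C :=
        StarSubalgebra.le_topologicalClosure _ (StarAlgebra.subset_adjoin ℂ _ (by simp))
      have hs : s ∈ C :=
        StarSubalgebra.le_topologicalClosure _ (StarAlgebra.subset_adjoin ℂ _ (by simp))
      let f : A →⋆ₐ[ℂ] B := C.subtype.comp (e : A →⋆ₐ[ℂ] C)
      have hf : Function.Injective f := Subtype.val_injective.comp e.injective
      have : Nontrivial A := f.toRingHom.domain_nontrivial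
      have hfu : f (e.symm ⟨u, hu⟩) = u := congrArg Subtype.val (e.apply_symm_apply ⟨u, hu⟩)
      have hfs : f (e.symm ⟨s, hs⟩) = s := congrArg Subtype.val (e.apply_symm_apply ⟨s, hs⟩)
      have hp : IsPair (e.symm ⟨u, hu⟩) (e.symm ⟨s, hs⟩) :=
        { unitary := Unitary.mem_iff.2
            ⟨hf (by simpa only [map_mul, map_star, map_one, hfu] using
                (Unitary.mem_iff.1 h.unitary).1),
              hf (by simpa only [map_mul, map_star, map_one, hfu] using
                (Unitary.mem_iff.1 h.unitary).2)⟩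
          isometry := hf (by simpa only [map_mul, map_star, map_one, hfs] using h.isometry)
          intertwine := hf (by simpa only [map_mul, map_pow, hfu, hfs] using h.intertwine)
          range_sum := hf (by
            simpa only [map_mul, map_add, map_star, map_one, hfu, hfs] using h.range_sum) }
      let π : Rep := ⟨A, _, _, hp⟩
      let ψ : Q₂ →⋆ₐ[ℂ] π.carrier := (evalHom π).comp universalSubalgebra.subtype
      exact ⟨f.comp ψ, hfu, hfs⟩
  · rintro φ ψ ⟨h1, h2⟩ ⟨h3, h4⟩
    exact hom_ext (h1.trans h3.symm) (h2.trans h4.symm)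

/-- The unital *-homomorphism out of `Q₂` given by the universal property. -/
def Q₂.lift {B : Type v} [CStarAlgebra B] {u s : B} (h : IsPair u s) : Q₂ →⋆ₐ[ℂ] B :=
  (existsUnique_hom h).choose

theorem Q₂.lift_u {B : Type v} [CStarAlgebra B] {u s : B} (h : IsPair u s) :
    Q₂.lift h Q₂.u = u := (existsUnique_hom h).choose_spec.1.1

theorem Q₂.lift_s₂ {B : Type v} [CStarAlgebra B] {u s : B} (h : IsPair u s) :
    Q₂.lift h Q₂.s₂ = s := (existsUnique_hom h).choose_spec.1.2

/-! ### The flip-flop symmetry -/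

/-- The pair `(u*, u s)` satisfies the relations as soon as `(u, s)` does. -/
theorem IsPair.flip {B : Type v} [CStarAlgebra B] {u s : B} (h : IsPair u s) :
    IsPair (star u) (u * s) := by
  have h1 := (Unitary.mem_iff.1 h.unitary).1
  have h2 := (Unitary.mem_iff.1 h.unitary).2
  refine ⟨Unitary.star_mem h.unitary, ?_, ?_, ?_⟩
  · rw [star_mul, mul_assoc, ← mul_assoc (star u), h1, one_mul, h.isometry]
  · calc u * s * star u = star u * (u ^ 2 * s) * star u := by
          rw [pow_two, ← mul_assoc, ← mul_assoc, h1, one_mul]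
      _ = star u * s := by rw [← h.intertwine, mul_assoc, mul_assoc, h2, mul_one]
      _ = star u ^ 2 * (u * s) := by
          rw [pow_two, mul_assoc, ← mul_assoc (star u) u, h1, one_mul]
  · calc u * s * star (u * s) + star u * (u * s * star (u * s)) * star (star u)
        = u * (s * star s) * star u + (star u * u) * (s * star s) * (star u * u) := by
          simp only [star_mul, star_star, mul_assoc]
      _ = 1 := by rw [h1, one_mul, mul_one, add_comm, h.range_sum]

/-- The endomorphism `u ↦ u*`, `s₂ ↦ s₁ = u s₂` of `Q₂`. -/
def flipFlopHom : Q₂ →⋆ₐ[ℂ] Q₂ := Q₂.lift isPair_gen.flip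

theorem flipFlopHom_u : flipFlopHom Q₂.u = star (Q₂.u : Q₂) := Q₂.lift_u _

theorem flipFlopHom_s₂ : flipFlopHom Q₂.s₂ = Q₂.s₁ := Q₂.lift_s₂ _

theorem flipFlopHom_comp : flipFlopHom.comp flipFlopHom = StarAlgHom.id ℂ Q₂ := by
  apply hom_ext
  · simp [flipFlopHom_u, map_star]
  · simp [flipFlopHom_s₂, flipFlopHom_u, Q₂.s₁, ← mul_assoc]

/-- The flip-flop symmetry `σ` of `Q₂`: the *-automorphism with `σ(s₂) = s₁`, `σ(u) = u*`. -/
def flipFlop : Q₂ ≃⋆ₐ[ℂ] Q₂ :=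
  StarAlgEquiv.ofStarAlgHom flipFlopHom flipFlopHom flipFlopHom_comp flipFlopHom_comp

theorem flipFlop_u : flipFlop Q₂.u = star (Q₂.u : Q₂) := flipFlopHom_u

theorem flipFlop_s₂ : flipFlop Q₂.s₂ = Q₂.s₁ := flipFlopHom_s₂

theorem flipFlop_s₁ : flipFlop Q₂.s₁ = Q₂.s₂ := by
  rw [← flipFlop_s₂]; exact congr($flipFlopHom_comp Q₂.s₂)

/-! ### Generated C*-subalgebras and fixed points -/

/-- `C*(S)`: the smallest (not necessarily unital) C*-subalgebra containing `S`. -/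
def genCStar {A : Type v} [CStarAlgebra A] (S : Set A) : NonUnitalStarSubalgebra ℂ A :=
  (NonUnitalStarAlgebra.adjoin ℂ S).topologicalClosure

/-- The fixed-point algebra of a *-automorphism. -/
def fixedPointAlgebra {A : Type v} [CStarAlgebra A] (σ : A ≃⋆ₐ[ℂ] A) :
    NonUnitalStarSubalgebra ℂ A where
  carrier := {x | σ x = x}
  add_mem' {x y} hx hy := by
    rw [Set.mem_ofPred_eq] at *; rw [map_add, hx, hy]
  zero_mem' := map_zero σ
  mul_mem' {x y} hx hy := by
    rw [Set.mem_ofPred_eq] at *; rw [map_mul, hx, hy]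
  smul_mem' c x hx := by
    rw [Set.mem_ofPred_eq] at *; rw [map_smul, hx]
  star_mem' {x} hx := by
    rw [Set.mem_ofPred_eq] at *; rw [map_star, hx]

namespace Q₂

/-- The canonical copy of the Cuntz algebra in `Q₂`. -/
def O₂ : NonUnitalStarSubalgebra ℂ Q₂ := genCStar {s₁, s₂}

/-- `T = (s₁ + s₂) / √2`. -/
def T : Q₂ := ((1 / √2 : ℝ) : ℂ) • (s₁ + s₂)

/-- `V = (s₁ - s₂)(s₁ s₁* - s₂ s₂*) / √2`. -/
def V : Q₂ := ((1 / √2 : ℝ) : ℂ) • ((s₁ - s₂) * (s₁ * star s₁ - s₂ * star s₂))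

/-- `R = u + u*`. -/
def R : Q₂ := u + star (u : Q₂)

end Q₂

end TwoAdic

end

/-! Write `B` for C*(T, V, R) and σ for the flip-flop. The self-adjoint unitary `W` = s₁s₁* - s₂s₂*
satisfies σ(W) = -W, and conjugation by it swaps `T` and `V` and negates `R`, so `W` normalizes `B`.
Hence B + WB should be a *-algebra graded by σ, with even part `B`. This is encoded in
`crossedSubalgebra` by conditions on x + σ(x) and W(x - σ(x)), which visibly pass to limits. Both
generators satisfy these conditions. For s₂ this is immediate; for u the key identity is
`star_V_mul_R_mul_T`, which puts W(u - u*) in `B`. So the closed subalgebra is all of `Q₂`, and a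
fixed point x equals (x + σ(x))/2, which lies in `B`. For the second equality, `T`, `V`, `R` are
multiples of elements xu^h + σ(x)u^(-h), and every such element is fixed by σ. -/

namespace TwoAdic

/-! ### Generated subalgebras and the even/odd decomposition relative to a symmetry -/

section General

variable {A : Type*} [CStarAlgebra A]

theorem subset_genCStar (S : Set A) : S ⊆ genCStar S :=
  (NonUnitalStarAlgebra.subset_adjoin ℂ S).trans
    (NonUnitalStarSubalgebra.le_topologicalClosure _)

theorem isClosed_genCStar (S : Set A) : IsClosed (genCStar S : Set A) :=
  NonUnitalStarSubalgebra.isClosed_topologicalClosure _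

theorem genCStar_le {S : Set A} {B : NonUnitalStarSubalgebra ℂ A} (hB : IsClosed (B : Set A))
    (h : S ⊆ B) : genCStar S ≤ B :=
  NonUnitalStarSubalgebra.topologicalClosure_minimal _ (NonUnitalStarAlgebra.adjoin_le h) hB

theorem continuous_starAlgEquiv (σ : A ≃⋆ₐ[ℂ] A) : Continuous σ :=
  (NonUnitalStarAlgHom.instContinuousLinearMapClassComplex
    (F := A ≃⋆ₐ[ℂ] A) (A := A) (B := A)).map_continuous σ

theorem isClosed_fixedPointAlgebra (σ : A ≃⋆ₐ[ℂ] A) :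
    IsClosed (fixedPointAlgebra σ : Set A) :=
  isClosed_eq (continuous_starAlgEquiv σ) continuous_id

/-- If `W` is a self-adjoint unitary normalizing a subalgebra `B` and `σ` is a *-automorphism, the
elements `x` with `x + σ x ∈ B` and `W (x - σ x) ∈ B` form a *-subalgebra: when `σ` is an
involution fixing `B` and sending `W` to `-W`, it is `B + W B`. -/
def crossedSubalgebra (σ : A ≃⋆ₐ[ℂ] A) (B : NonUnitalStarSubalgebra ℂ A) (W : A)
    (hone : (1 : A) ∈ B) (hstar : star W = W) (hsq : W * W = 1)
    (hconj : ∀ b ∈ B, W * b * W ∈ B) : StarSubalgebra ℂ A where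
  carrier := {x | x + σ x ∈ B ∧ W * (x - σ x) ∈ B}
  mul_mem' {x y} hx hy := by
    obtain ⟨hx1, hx2⟩ := hx
    obtain ⟨hy1, hy2⟩ := hy
    have hx3 : (x - σ x) * W ∈ B := by
      simpa only [← mul_assoc, hsq, one_mul] using hconj _ hx2
    have hx4 := hconj _ hx1
    -- Parity rule: the even part of a product is even·even + odd·odd, the odd part even·odd +
    -- odd·even. Inserting W² = 1 makes every factor an element of `B`.
    have e1 : x * y + σ (x * y) = (2⁻¹ : ℂ) • ((x + σ x) * (y + σ y)
        + ((x - σ x) * W) * (W * (y - σ y))) := by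
      rw [mul_assoc _ W, ← mul_assoc W W, hsq, one_mul, eq_inv_smul_iff₀ two_ne_zero, two_smul,
        map_mul]
      noncomm_ring
    have e2 : W * (x * y - σ (x * y)) = (2⁻¹ : ℂ) • ((W * (x + σ x) * W) * (W * (y - σ y))
        + (W * (x - σ x)) * (y + σ y)) := by
      rw [mul_assoc _ W, ← mul_assoc W W, hsq, one_mul, eq_inv_smul_iff₀ two_ne_zero, two_smul,
        map_mul]
      noncomm_ring
    refine ⟨?_, ?_⟩
    · rw [e1]; exact SMulMemClass.smul_mem _ (add_mem (mul_mem hx1 hy1) (mul_mem hx3 hy2))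
    · rw [e2]; exact SMulMemClass.smul_mem _ (add_mem (mul_mem hx4 hy2) (mul_mem hx2 hy1))
  add_mem' {x y} hx hy := by
    refine ⟨?_, ?_⟩
    · rw [map_add, add_add_add_comm]; exact add_mem hx.1 hy.1
    · rw [map_add, add_sub_add_comm, mul_add]; exact add_mem hx.2 hy.2
  algebraMap_mem' r := by
    rw [Set.mem_ofPred_eq, Algebra.algebraMap_eq_smul_one, map_smul, map_one, sub_self, mul_zero]
    exact ⟨add_mem (SMulMemClass.smul_mem r hone) (SMulMemClass.smul_mem r hone), zero_mem B⟩
  star_mem' {x} hx := by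
    refine ⟨?_, ?_⟩
    · rw [map_star, ← star_add]; exact star_mem hx.1
    · have h : W * (star x - σ (star x)) = star (W * (W * (x - σ x)) * W) := by
        rw [← mul_assoc, hsq, one_mul, star_mul, star_sub, hstar, map_star]
      rw [h]; exact star_mem (hconj _ hx.2)

theorem mem_crossedSubalgebra {σ : A ≃⋆ₐ[ℂ] A} {B : NonUnitalStarSubalgebra ℂ A} {W : A}
    {hone : (1 : A) ∈ B} {hstar : star W = W} {hsq : W * W = 1}
    {hconj : ∀ b ∈ B, W * b * W ∈ B} {x : A} :
    x ∈ crossedSubalgebra σ B W hone hstar hsq hconj ↔ x + σ x ∈ B ∧ W * (x - σ x) ∈ B :=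
  Iff.rfl

theorem isClosed_crossedSubalgebra (σ : A ≃⋆ₐ[ℂ] A) (B : NonUnitalStarSubalgebra ℂ A) (W : A)
    (hone : (1 : A) ∈ B) (hstar : star W = W) (hsq : W * W = 1)
    (hconj : ∀ b ∈ B, W * b * W ∈ B) (hB : IsClosed (B : Set A)) :
    IsClosed (crossedSubalgebra σ B W hone hstar hsq hconj : Set A) := by
  have hσ := continuous_starAlgEquiv σ
  exact (hB.preimage (continuous_id.add hσ)).inter
    (hB.preimage (continuous_const.mul (continuous_id.sub hσ)))

/-- Conjugation by a self-adjoint unitary is a *-automorphism, hence continuous, so generators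
suffice. -/
theorem conj_mem_genCStar {S : Set A} {W : A} (hstar : star W = W) (hsq : W * W = 1)
    (hS : ∀ x ∈ S, W * x * W ∈ genCStar S) {b : A} (hb : b ∈ genCStar S) :
    W * b * W ∈ genCStar S := by
  let w : unitary A := ⟨W, Unitary.mem_iff.2 (by rw [hstar]; exact ⟨hsq, hsq⟩)⟩
  let f : A ≃⋆ₐ[ℂ] A := Unitary.conjStarAlgAut ℂ A w
  have hf : ∀ x, f x = W * x * W := fun x => congrArg (W * x * ·) hstar
  have hle : genCStar S ≤ NonUnitalStarSubalgebra.comap f (genCStar S) :=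
    genCStar_le ((isClosed_genCStar S).preimage (continuous_starAlgEquiv f))
      fun x hx => by
        change f x ∈ genCStar S
        rw [hf]; exact hS x hx
  have : f b ∈ genCStar S := hle hb
  rwa [hf] at this

end General

/-! ### Cuntz relations and the symmetry `W` -/

namespace Q₂

theorem star_u_mul_u : star (u : Q₂) * u = 1 := (Unitary.mem_iff.1 u.2).1

theorem u_mul_star_u : (u : Q₂) * star (u : Q₂) = 1 := (Unitary.mem_iff.1 u.2).2

theorem star_s₂_mul_s₂ : star s₂ * s₂ = 1 := isPair_gen.isometry

theorem star_s₁_mul_s₁ : star s₁ * s₁ = 1 := isPair_gen.flip.isometry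

theorem s₁_mul_star_s₁ : s₁ * star s₁ = u * (s₂ * star s₂) * star (u : Q₂) := by
  simp only [s₁, star_mul, mul_assoc]

theorem range_sum : s₁ * star s₁ + s₂ * star s₂ = 1 := by
  rw [s₁_mul_star_s₁, add_comm]; exact isPair_gen.range_sum

theorem star_s₁_mul_s₂ : star s₁ * s₂ = 0 := by
  -- Expanding the left side gives s₁*s₂ twice, so it vanishes.
  have h : star s₁ * (s₁ * star s₁ + s₂ * star s₂) * s₂ = star s₁ * s₂ := by
    rw [range_sum, mul_one]
  rw [mul_add, add_mul, ← mul_assoc, star_s₁_mul_s₁, one_mul, ← mul_assoc, mul_assoc,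
    star_s₂_mul_s₂, mul_one] at h
  exact left_eq_add.1 h.symm

theorem star_s₂_mul_s₁ : star s₂ * s₁ = 0 := by
  rw [← star_star s₁, ← star_mul, star_s₁_mul_s₂, star_zero]

theorem u_mul_s₁ : (u : Q₂) * s₁ = s₂ * u := by
  rw [s₁, ← mul_assoc, ← pow_two, isPair_gen.intertwine]

theorem star_u_mul_s₁ : star (u : Q₂) * s₁ = s₂ := by
  rw [s₁, ← mul_assoc, star_u_mul_u, one_mul]

theorem star_u_mul_s₂ : star (u : Q₂) * s₂ = s₁ * star (u : Q₂) := by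
  rw [← mul_one (star (u : Q₂) * s₂), ← u_mul_star_u, ← mul_assoc, mul_assoc _ s₂, ← u_mul_s₁,
    ← mul_assoc, star_u_mul_u, one_mul]

/-- The symmetry `s₁ s₁* - s₂ s₂*`. -/
noncomputable def W : Q₂ := s₁ * star s₁ - s₂ * star s₂

theorem star_W : star W = W := by simp [W]

theorem W_mul_s₁ : W * s₁ = s₁ := by
  rw [W, sub_mul, mul_assoc, mul_assoc, star_s₁_mul_s₁, star_s₂_mul_s₁, mul_one, mul_zero, sub_zero]

theorem W_mul_s₂ : W * s₂ = -s₂ := by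
  rw [W, sub_mul, mul_assoc, mul_assoc, star_s₁_mul_s₂, star_s₂_mul_s₂, mul_one, mul_zero, zero_sub]

theorem W_mul_W : W * W = 1 := by
  nth_rw 2 [W]
  rw [mul_sub, ← mul_assoc, ← mul_assoc, W_mul_s₁, W_mul_s₂, neg_mul, sub_neg_eq_add, range_sum]

/-- Conjugation by u exchanges the complementary range projections of s₁ and s₂. -/
theorem u_mul_W : (u : Q₂) * W = -(W * u) := by
  have h1 : (u : Q₂) * (s₂ * star s₂) = s₁ * star s₁ * u := by
    rw [s₁_mul_star_s₁, mul_assoc, star_u_mul_u, mul_one]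
  have h2 : (u : Q₂) * (s₁ * star s₁) = s₂ * star s₂ * u := by
    rw [eq_sub_of_add_eq range_sum, mul_sub, mul_one, h1, eq_sub_of_add_eq' range_sum, sub_mul,
      one_mul]
  rw [W, mul_sub, h1, h2, ← sub_mul, ← neg_mul, neg_sub]

theorem star_u_mul_W : star (u : Q₂) * W = -(W * star (u : Q₂)) := by
  have h := congrArg star u_mul_W
  rw [star_neg, star_mul, star_mul, star_W] at h
  rw [h, neg_neg]

theorem W_conj_T : W * T * W = V := by
  rw [T, mul_smul_comm, mul_add, W_mul_s₁, W_mul_s₂, ← sub_eq_add_neg, smul_mul_assoc, V, W]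

theorem W_conj_V : W * V * W = T := by
  rw [← W_conj_T, mul_assoc, mul_assoc, mul_assoc, W_mul_W, mul_one, ← mul_assoc, W_mul_W, one_mul]

theorem W_conj_R : W * R * W = -R := by
  rw [R, mul_assoc, add_mul, u_mul_W, star_u_mul_W, ← neg_add, ← mul_add, mul_neg, ← mul_assoc,
    W_mul_W, one_mul]

theorem inv_sqrt_two_mul_self : ((1 / √2 : ℝ) : ℂ) * ((1 / √2 : ℝ) : ℂ) = 1 / 2 := by
  rw [← Complex.ofReal_mul, div_mul_div_comm, Real.mul_self_sqrt zero_le_two]; norm_num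

theorem inv_sqrt_two_ne_zero : ((1 / √2 : ℝ) : ℂ) ≠ 0 := by
  rw [Complex.ofReal_ne_zero]; positivity

theorem star_T_mul_T : star T * T = 1 := by
  rw [T, star_smul, smul_mul_smul_comm, RCLike.star_def, Complex.conj_ofReal,
    inv_sqrt_two_mul_self, star_add, add_mul, mul_add, mul_add, star_s₁_mul_s₁, star_s₁_mul_s₂,
    star_s₂_mul_s₁, star_s₂_mul_s₂, add_zero, zero_add, ← two_smul ℂ (1 : Q₂), smul_smul]
  norm_num

/-- This places the odd part of u in W·C*(T, V, R). Left multiplication by (s₁ - s₂)* sends s₁ to 1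
and s₂ to -1, so in R(s₁ + s₂) = s₂u + s₁ + s₂ + s₁u* the middle terms cancel and u* - u remains. -/
theorem star_V_mul_R_mul_T :
    star V * (R * T) = (-(1 / 2) : ℂ) • (W * (u - star (u : Q₂))) := by
  have h : R * (s₁ + s₂) = s₂ * u + s₁ + s₂ + s₁ * star (u : Q₂) := by
    rw [R, add_mul, mul_add, mul_add, u_mul_s₁, star_u_mul_s₁, star_u_mul_s₂, s₁]
    abel
  have e1 : star (s₁ - s₂) * s₁ = 1 := by
    rw [star_sub, sub_mul, star_s₁_mul_s₁, star_s₂_mul_s₁, sub_zero]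
  have e2 : star (s₁ - s₂) * s₂ = -1 := by
    rw [star_sub, sub_mul, star_s₁_mul_s₂, star_s₂_mul_s₂, zero_sub]
  have hV : V = ((1 / √2 : ℝ) : ℂ) • ((s₁ - s₂) * W) := rfl
  have e3 : star (s₁ - s₂) * (s₂ * u + s₁ + s₂ + s₁ * star (u : Q₂)) = -(u - star (u : Q₂)) := by
    simp only [mul_add, ← mul_assoc, e1, e2]
    noncomm_ring
  rw [hV, T, mul_smul_comm, star_smul, smul_mul_smul_comm, RCLike.star_def, Complex.conj_ofReal,
    inv_sqrt_two_mul_self, h, star_mul, star_W, mul_assoc, e3, mul_neg, smul_neg, neg_smul]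

/-! ### Action of the flip-flop and the fixed-point algebra -/

theorem flipFlop_flipFlop (x : Q₂) : flipFlop (flipFlop x) = x := congr($flipFlopHom_comp x)

theorem flipFlop_u_zpow (h : ℤ) :
    flipFlop ((u ^ h : unitary Q₂) : Q₂) = ((u ^ (-h) : unitary Q₂) : Q₂) := by
  let f : unitary Q₂ →⋆* unitary Q₂ := Unitary.map (StarMonoidHom.ofClass flipFlop)
  have hu : f u = u⁻¹ := Subtype.ext flipFlop_u
  have h1 : f (u ^ h) = u ^ (-h) := by rw [map_zpow, hu, inv_zpow']
  exact congrArg Subtype.val h1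

theorem flipFlop_T : flipFlop T = T := by
  rw [T, map_smul, map_add, flipFlop_s₁, flipFlop_s₂, add_comm]

theorem flipFlop_W : flipFlop W = -W := by
  rw [W, map_sub, map_mul, map_mul, map_star, map_star, flipFlop_s₁, flipFlop_s₂, neg_sub]

theorem flipFlop_V : flipFlop V = V := by
  rw [← W_conj_T, map_mul, map_mul, flipFlop_W, flipFlop_T, neg_mul, neg_mul_neg]

theorem flipFlop_R : flipFlop R = R := by
  rw [R, map_add, map_star, flipFlop_u, star_star, add_comm]

/-- `genCStar` is not unital by construction; the unit comes from `T` being an isometry. -/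
theorem one_mem_genCStar_TVR : (1 : Q₂) ∈ genCStar {T, V, R} := by
  have hT : T ∈ genCStar {T, V, R} := subset_genCStar _ (by simp)
  rw [← star_T_mul_T]; exact mul_mem (star_mem hT) hT

theorem W_conj_mem {b : Q₂} (hb : b ∈ genCStar {T, V, R}) : W * b * W ∈ genCStar {T, V, R} := by
  refine conj_mem_genCStar star_W W_mul_W ?_ hb
  rintro x (rfl | rfl | rfl)
  · rw [W_conj_T]; exact subset_genCStar _ (by simp)
  · rw [W_conj_V]; exact subset_genCStar _ (by simp)
  · rw [W_conj_R]; exact neg_mem (subset_genCStar _ (by simp))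

theorem crossedSubalgebra_flipFlop_eq_top :
    crossedSubalgebra flipFlop (genCStar {T, V, R}) W one_mem_genCStar_TVR star_W W_mul_W
      (fun _ => W_conj_mem) = ⊤ := by
  have hT : T ∈ genCStar {T, V, R} := subset_genCStar _ (by simp)
  have hV : V ∈ genCStar {T, V, R} := subset_genCStar _ (by simp)
  have hR : R ∈ genCStar {T, V, R} := subset_genCStar _ (by simp)
  rw [eq_top_iff, ← dense_adjoin]
  refine StarSubalgebra.topologicalClosure_minimal (StarAlgebra.adjoin_le ?_)
    (isClosed_crossedSubalgebra _ _ _ _ _ _ _ (isClosed_genCStar _))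
  have hs : s₁ + s₂ ∈ genCStar {T, V, R} := by
    rw [← inv_smul_smul₀ inv_sqrt_two_ne_zero (s₁ + s₂)]
    exact SMulMemClass.smul_mem _ hT
  rintro x (rfl | rfl)
  · refine mem_crossedSubalgebra.2 ⟨by rwa [flipFlop_u], ?_⟩
    have h := (eq_inv_smul_iff₀ (by norm_num)).2 star_V_mul_R_mul_T.symm
    rw [flipFlop_u, h]
    exact SMulMemClass.smul_mem _ (mul_mem (star_mem hV) (mul_mem hR hT))
  · refine mem_crossedSubalgebra.2 ⟨?_, ?_⟩
    · rwa [flipFlop_s₂, add_comm]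
    -- `W` fixes s₁ and negates s₂, so W(s₂ - s₁) = -(s₁ + s₂), again a multiple of `T`.
    · rw [flipFlop_s₂, mul_sub, W_mul_s₁, W_mul_s₂, ← neg_add', add_comm]
      exact neg_mem hs

theorem fixedPointAlgebra_flipFlop : fixedPointAlgebra flipFlop = genCStar {T, V, R} := by
  apply le_antisymm
  · intro x hx
    have hσ : flipFlop x = x := hx
    have h : x ∈ crossedSubalgebra flipFlop (genCStar {T, V, R}) W one_mem_genCStar_TVR star_W
        W_mul_W (fun _ => W_conj_mem) := by
      rw [crossedSubalgebra_flipFlop_eq_top]; trivial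
    have h2 := (mem_crossedSubalgebra.1 h).1
    rw [hσ, ← two_smul ℂ] at h2
    rw [← inv_smul_smul₀ (two_ne_zero' ℂ) x]
    exact SMulMemClass.smul_mem _ h2
  · refine genCStar_le (isClosed_fixedPointAlgebra _) ?_
    rintro x (rfl | rfl | rfl)
    · exact flipFlop_T
    · exact flipFlop_V
    · exact flipFlop_R

theorem s₁_mem_O₂ : s₁ ∈ O₂ := subset_genCStar _ (by simp)

theorem s₂_mem_O₂ : s₂ ∈ O₂ := subset_genCStar _ (by simp)

theorem V_mem_O₂ : V ∈ O₂ :=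
  SMulMemClass.smul_mem _ (mul_mem (sub_mem s₁_mem_O₂ s₂_mem_O₂)
    (sub_mem (mul_mem s₁_mem_O₂ (star_mem s₁_mem_O₂))
      (mul_mem s₂_mem_O₂ (star_mem s₂_mem_O₂))))

theorem one_mem_O₂ : (1 : Q₂) ∈ O₂ := by
  rw [← star_s₁_mul_s₁]; exact mul_mem (star_mem s₁_mem_O₂) s₁_mem_O₂

end Q₂

end TwoAdic

open TwoAdic Q₂ in
theorem theorem4p5 :
    TwoAdic.fixedPointAlgebra TwoAdic.flipFlop
        = TwoAdic.genCStar {TwoAdic.Q₂.T, TwoAdic.Q₂.V, TwoAdic.Q₂.R} ∧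
      TwoAdic.genCStar {TwoAdic.Q₂.T, TwoAdic.Q₂.V, TwoAdic.Q₂.R}
        = TwoAdic.genCStar {y : TwoAdic.Q₂ | ∃ x ∈ TwoAdic.Q₂.O₂, ∃ h : ℤ,
            y = x * ((TwoAdic.Q₂.u ^ h : unitary TwoAdic.Q₂) : TwoAdic.Q₂)
              + TwoAdic.flipFlop x *
                ((TwoAdic.Q₂.u ^ (-h) : unitary TwoAdic.Q₂) : TwoAdic.Q₂)} := by
  refine ⟨fixedPointAlgebra_flipFlop, le_antisymm ?_ ?_⟩
  · refine genCStar_le (isClosed_genCStar _) ?_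
    rintro x (rfl | rfl | rfl)
    -- Witnesses (x, h): (s₁, 0) gives √2·T, (V, 0) gives 2V, and (1, 1) gives `R`.
    · refine SMulMemClass.smul_mem _ (subset_genCStar _ ⟨s₁, s₁_mem_O₂, 0, ?_⟩)
      simp [flipFlop_s₁]
    · rw [← inv_smul_smul₀ (two_ne_zero' ℂ) V]
      refine SMulMemClass.smul_mem _ (subset_genCStar _ ⟨V, V_mem_O₂, 0, ?_⟩)
      simp [flipFlop_V, two_smul]
    · refine subset_genCStar _ ⟨1, one_mem_O₂, 1, ?_⟩
      simp [R, ← Unitary.star_eq_inv]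
  · rw [← fixedPointAlgebra_flipFlop]
    refine genCStar_le (isClosed_fixedPointAlgebra _) ?_
    rintro _ ⟨x, -, h, rfl⟩
    change flipFlop _ = _
    -- σ is an involution that interchanges the two summands.
    rw [map_add, map_mul, map_mul, flipFlop_u_zpow, flipFlop_u_zpow, flipFlop_flipFlop, neg_neg,
      add_comm]
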